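/- For a finite field $\mathbb F$ of characteristic $p$, a nontrivial additive character $\psi:\mathbb F\to\mathbb C^\times$ and $\alpha\in\mathbb F^\times$, put $$\mathrm{Kl}_{\mathbb F}(\psi;\alpha):=-\sum_{x\in\mathbb F^\times}\psi\left(x+\frac{\alpha}{x}\right).$$ For an odd prime $p$, call a real number $c>0$ an angle constant for $p$ if, for every finite field $\mathbb F$ of characteristic $p$, every nontrivial additive character $\psi$ on $\mathbb F$ and every $\alpha\in\mathbb F^\times$, one has $\mathrm{Kl}_{\mathbb F}(\psi;\alpha)=2|\mathbb F|^{1/2}\cos\theta$ for a (necessarily unique) angle $\theta=\theta_{\mathbb F}(\psi;\alpha)\in[0,\pi]$, and $$|\theta|>|\mathbb F|^{-c},\qquad |\pi-\theta|>|\mathbb F|^{-c}.$$ Let $p\ge 3$ be a prime. Then $2(p-1)$ is an angle constant for $p$. Moreover, if $c_p$ is any angle constant for $p$ (in particular, if $c_p=2(p-1)$), then for every finite field $\mathbb F$ of characteristic $p$, every nontrivial additive character $\psi$ on $\mathbb F$ and every $\alpha\in\mathbb F^\times$, $$|\mathrm{Kl}_{\mathbb F}(\psi;\alpha)|\le 2|\mathbb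 F|^{1/2}\left(1-\frac{2}{\pi^2}\,|\mathbb F|^{-2c_p}\right).$$ -/

import Mathlib

universe u

/-- The Kloosterman sum `Kl_F(ψ; α) = - ∑_{x ∈ Fˣ} ψ(x + α / x)`, normalised by a minus sign. -/
noncomputable def kloostermanSum {F : Type u} [Field F] [Fintype F] [DecidableEq F]
    (ψ : AddChar F ℂ) (α : Fˣ) : ℂ :=
  -∑ x : Fˣ, ψ ((x : F) + (α : F) / (x : F))

/-- `θ` is the angle of the Kloosterman sum: `θ ∈ [0, π]` and
`Kl_F(ψ; α) = 2 |F|^{1/2} cos θ`. There is at most one such `θ`, as `cos` is injective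
on `[0, π]`. -/
def IsKloostermanAngle {F : Type u} [Field F] [Fintype F] [DecidableEq F]
    (ψ : AddChar F ℂ) (α : Fˣ) (θ : ℝ) : Prop :=
  θ ∈ Set.Icc 0 Real.pi ∧
    kloostermanSum ψ α = ((2 * (Fintype.card F : ℝ) ^ (1 / 2 : ℝ) * Real.cos θ : ℝ) : ℂ)

/-- `c > 0` is an angle constant for `p`: for every finite field `F` of characteristic `p`,
every nontrivial additive character `ψ` of `F` and every `α ∈ Fˣ`, the angle `θ` of
`Kl_F(ψ; α)` (whose existence is part of the condition) satisfies
`|θ| > |F|^{-c}` and `|π - θ| > |F|^{-c}`. -/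
def IsKloostermanAngleConstant (p : ℕ) (c : ℝ) : Prop :=
  0 < c ∧
    ∀ (F : Type u) [Field F] [Fintype F] [DecidableEq F] [CharP F p]
      (ψ : AddChar F ℂ) (_ : ψ ≠ 1) (α : Fˣ),
      ∃ θ : ℝ, IsKloostermanAngle ψ α θ ∧
        (Fintype.card F : ℝ) ^ (-c) < |θ| ∧
        (Fintype.card F : ℝ) ^ (-c) < |Real.pi - θ|

open Finset in
theorem kloostermanSum_eq_neg_sum_ite {F : Type u} [Field F] [Fintype F] [DecidableEq F]
    (ψ : AddChar F ℂ) (α : Fˣ) :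
    kloostermanSum ψ α = -∑ x : F, if x = 0 then 0 else ψ (x + α / x) := by
  unfold kloostermanSum
  congr 1
  rw [← Finset.sum_filter_add_sum_filter_not univ (fun x : F => x = 0)]
  rw [Finset.sum_eq_zero (s := univ.filter (fun x : F => x = 0)), zero_add]
  · refine Finset.sum_bij (fun x _ => (x : F)) ?_ ?_ ?_ ?_
    · intro x _; simp
    · intro x _ y _ h; exact Units.ext h
    · intro b hb
      exact ⟨Units.mk0 b (by simpa using hb), by simp, rfl⟩
    · intro x _; simp
  · intro x hx
    simp at hx
    simp [hx]

theorem conj_kloostermanSum {F : Type u} [Field F] [Fintype F] [DecidableEq F]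
    (ψ : AddChar F ℂ) (α : Fˣ) :
    (starRingEnd ℂ) (kloostermanSum ψ α) = kloostermanSum ψ α := by
  unfold kloostermanSum
  rw [map_neg, map_sum]
  congr 1
  refine Fintype.sum_equiv (Equiv.neg Fˣ) _ _ fun x => ?_
  rw [← AddChar.map_neg_eq_conj]
  congr 1
  simp [div_neg]
  ring

theorem kloostermanSum_eq_ofReal_re {F : Type u} [Field F] [Fintype F] [DecidableEq F]
    (ψ : AddChar F ℂ) (α : Fˣ) :
    ((kloostermanSum ψ α).re : ℂ) = kloostermanSum ψ α :=
  Complex.conj_eq_iff_re.mp (conj_kloostermanSum ψ α)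

section Quadratic

variable {F : Type u} [Field F] [Fintype F] [DecidableEq F]

theorem card_sq_eq (hF : ringChar F ≠ 2) (a : F) :
    ((Finset.univ.filter fun x : F => x ^ 2 = a).card : ℤ) = quadraticChar F a + 1 := by
  rw [← quadraticChar_card_sqrts hF a]
  congr 2
  ext x
  simp

theorem sum_comp_sq_add_sum_comp_mul_sq (hF : ringChar F ≠ 2) {d : F} (hd : ¬ IsSquare d)
    (h : F → ℂ) : ∑ b, h (b ^ 2) + ∑ b, h (d * b ^ 2) = 2 * ∑ c, h c := by
  have hd0 : d ≠ 0 := by rintro rfl; exact hd (IsSquare.zero)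
  rw [← Finset.sum_fiberwise' Finset.univ (fun b : F => b ^ 2) h,
    ← Finset.sum_fiberwise' Finset.univ (fun b : F => d * b ^ 2) h, ← Finset.sum_add_distrib,
    Finset.mul_sum]
  refine Finset.sum_congr rfl fun c _ => ?_
  rw [Finset.sum_const, Finset.sum_const, ← add_nsmul, nsmul_eq_mul]
  congr 1
  have h1 := card_sq_eq hF c
  have h2 := card_sq_eq hF (c / d)
  have h3 : quadraticChar F (c / d) = - quadraticChar F c := by
    have := map_mul (quadraticChar F) (c / d) d
    rw [div_mul_cancel₀ _ hd0, quadraticChar_neg_one_iff_not_isSquare.mpr hd] at this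
    rw [this]; ring
  have h4 : (Finset.univ.filter fun x : F => d * x ^ 2 = c)
      = Finset.univ.filter fun x : F => x ^ 2 = c / d := by
    ext x
    simp [eq_div_iff hd0, mul_comm]
  rw [h4]
  have h5 : ((Finset.univ.filter fun x : F => x ^ 2 = c).card : ℤ)
    + (Finset.univ.filter fun x : F => x ^ 2 = c / d).card = 2 := by
    rw [h1, h2, h3]; ring
  exact_mod_cast h5

theorem sum_addChar_mul (ψ : AddChar F ℂ) (hψ : ψ ≠ 1) (c : F) :
    ∑ s, ψ (s * c) = if c = 0 then (Fintype.card F : ℂ) else 0 := by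
  have := AddChar.sum_mulShift c (AddChar.IsPrimitive.of_ne_one hψ)
  rw [this]
  split_ifs <;> simp

theorem sum_sum_addChar_trace_norm (ψ : AddChar F ℂ) (hψ : ψ ≠ 1) (α : Fˣ) :
    ∑ s : F, ∑ t : F, (if t = 0 then 0 else ψ (s + α * s / t)) = (Fintype.card F : ℂ) := by
  rw [Finset.sum_comm, Finset.sum_eq_single (-(α : F))]
  · have : (-(α : F)) ≠ 0 := by simp
    simp only [this, if_false]
    have h : ∀ s : F, s + α * s / (-(α : F)) = 0 := by
      intro s
      field_simp
      ring
    simp [h]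
  · intro t _ ht
    by_cases h0 : t = 0
    · simp [h0]
    · simp only [h0, if_false]
      have h : ∀ s : F, s + α * s / t = s * (1 + α / t) := by
        intro s; ring
      simp_rw [h]
      rw [sum_addChar_mul ψ hψ, if_neg]
      intro h1
      apply ht
      field_simp at h1
      linear_combination h1
  · simp

/-- The two-variable summand common to the square of a Kloosterman sum and to the Kloosterman sum
over a quadratic extension, as a function of the sum `s` and the product `t`. -/
noncomputable def symmKloostermanTerm (ψ : AddChar F ℂ) (α : Fˣ) (s t : F) : ℂ :=
  if t = 0 then 0 else ψ (s + α * s / t)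

theorem sq_kloostermanSum (hF : ringChar F ≠ 2) (ψ : AddChar F ℂ) (α : Fˣ) :
    kloostermanSum ψ α ^ 2 = ∑ a : F, ∑ b : F, symmKloostermanTerm ψ α (2 * a) (a ^ 2 - b ^ 2) := by
  have h2 : (2 : F) ≠ 0 := Ring.two_ne_zero hF
  rw [kloostermanSum_eq_neg_sum_ite, neg_sq, sq, Finset.sum_mul_sum, ← Finset.sum_product',
    ← Finset.sum_product']
  refine Finset.sum_bij' (fun z _ => ((z.1 + z.2) / 2, (z.1 - z.2) / 2))
    (fun z _ => (z.1 + z.2, z.1 - z.2)) (by simp) (by simp) ?_ ?_ ?_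
  · rintro ⟨x, y⟩ _
    ext <;> simp <;> field_simp <;> ring
  · rintro ⟨x, y⟩ _
    ext <;> simp <;> field_simp <;> ring
  · rintro ⟨x, y⟩ _
    have h : ((x + y) / 2) ^ 2 - ((x - y) / 2) ^ 2 = x * y := by field_simp; ring
    simp only [symmKloostermanTerm, h, mul_eq_zero]
    by_cases hx : x = 0
    · simp [hx]
    by_cases hy : y = 0
    · simp [hy]
    simp only [hx, hy, if_false, or_self]
    rw [← AddChar.map_add_eq_mul]
    congr 1
    field_simp
    ring

end Quadratic

section Extension

variable {F : Type u} [Field F] [Fintype F] {d : F}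

/-- The trace of a quadratic algebra `F[√d]`, as an additive map. -/
def quadraticTrace (d : F) : QuadraticAlgebra F d 0 →+ F where
  toFun z := 2 * z.re
  map_zero' := by simp
  map_add' x y := by simp [mul_add]

instance quadraticAlgebraFintype : Fintype (QuadraticAlgebra F d 0) :=
  Fintype.ofEquiv _ (QuadraticAlgebra.equivProd d 0).symm

theorem card_quadraticAlgebra :
    Fintype.card (QuadraticAlgebra F d 0) = Fintype.card F ^ 2 := by
  rw [Fintype.card_congr (QuadraticAlgebra.equivProd d 0), Fintype.card_prod, sq]

theorem kloostermanSum_quadraticAlgebra [DecidableEq F]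
    [Fact (∀ r : F, r ^ 2 ≠ d + 0 * r)] [DecidableEq (QuadraticAlgebra F d 0)] (ψ : AddChar F ℂ) (α : Fˣ) :
    kloostermanSum (ψ.compAddMonoidHom (quadraticTrace d))
        (Units.map (algebraMap F (QuadraticAlgebra F d 0)).toMonoidHom α)
      = -∑ a : F, ∑ b : F, symmKloostermanTerm ψ α (2 * a) (a ^ 2 - d * b ^ 2) := by
  rw [kloostermanSum_eq_neg_sum_ite, ← Finset.sum_product']
  congr 1
  refine Fintype.sum_equiv (QuadraticAlgebra.equivProd d 0) _ _ fun z => ?_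
  have hn : QuadraticAlgebra.norm z = z.re ^ 2 - d * z.im ^ 2 := by
    rw [QuadraticAlgebra.norm_def]; ring
  simp only [symmKloostermanTerm, QuadraticAlgebra.equivProd, Equiv.coe_fn_mk, ← hn,
    QuadraticAlgebra.norm_eq_zero_iff_eq_zero]
  split_ifs with hz
  · rfl
  · simp only [AddChar.compAddMonoidHom_apply, quadraticTrace, AddMonoidHom.coe_mk,
      ZeroHom.coe_mk]
    congr 1
    rw [div_eq_mul_inv]
    simp [QuadraticAlgebra.inv_def]
    ring

theorem kloostermanSum_quadraticAlgebra_eq_sq_sub (hF : ringChar F ≠ 2)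
    [hd : Fact (∀ r : F, r ^ 2 ≠ d + 0 * r)]
    [DecidableEq F] [DecidableEq (QuadraticAlgebra F d 0)] (ψ : AddChar F ℂ) (hψ : ψ ≠ 1) (α : Fˣ) :
    kloostermanSum (ψ.compAddMonoidHom (quadraticTrace d))
        (Units.map (algebraMap F (QuadraticAlgebra F d 0)).toMonoidHom α)
      = kloostermanSum ψ α ^ 2 - 2 * Fintype.card F := by
  have hd' : ¬ IsSquare d := by
    rintro ⟨r, hr⟩
    exact hd.out r (by rw [hr]; ring)
  have h2 : (2 : F) ≠ 0 := Ring.two_ne_zero hF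
  have key : ∑ a : F, ∑ b : F, symmKloostermanTerm ψ α (2 * a) (a ^ 2 - b ^ 2)
      + ∑ a : F, ∑ b : F, symmKloostermanTerm ψ α (2 * a) (a ^ 2 - d * b ^ 2)
      = 2 * Fintype.card F := by
    rw [← Finset.sum_add_distrib, ← sum_sum_addChar_trace_norm ψ hψ α, Finset.mul_sum]
    refine Fintype.sum_equiv (Equiv.mulLeft₀ (2 : F) h2) _ _ fun a => ?_
    rw [sum_comp_sq_add_sum_comp_mul_sq hF hd'
      (fun c => symmKloostermanTerm ψ α (2 * a) (a ^ 2 - c))]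
    congr 1
    exact Fintype.sum_equiv (Equiv.subLeft (a ^ 2)) _ _ fun c => by simp [symmKloostermanTerm]
  rw [kloostermanSum_quadraticAlgebra, sq_kloostermanSum hF]
  linear_combination -key

end Extension

section Stepanov

open Polynomial

variable {E : Type u} [Field E]

theorem eq_zero_of_sq_eq_C_mul_sq_mul_squarefree {f u v : E[X]} (hf : Squarefree f)
    (hdeg : 0 < f.natDegree) {c : E} (hc : c ≠ 0) (h : u ^ 2 = C c * (v ^ 2 * f)) : v = 0 := by
  induction hn : v.natDegree using Nat.strong_induction_on generalizing u v with
  | _ n ih =>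
    have hf0 : f ≠ 0 := hf.ne_zero
    obtain ⟨u', rfl⟩ : f ∣ u := (hf.dvd_pow_iff_dvd two_ne_zero).mp
      ⟨C c * v ^ 2, by rw [h]; ring⟩
    have h1 : f * u' ^ 2 = C c * v ^ 2 := mul_left_cancel₀ hf0 (by linear_combination h)
    obtain ⟨v', rfl⟩ : f ∣ v := (hf.dvd_pow_iff_dvd two_ne_zero).mp
      ⟨C c⁻¹ * u' ^ 2, by
        have : C c⁻¹ * C c = 1 := by rw [← C_mul, inv_mul_cancel₀ hc, C_1]
        linear_combination -v ^ 2 * this - C c⁻¹ * h1⟩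
    have h2 : u' ^ 2 = C c * (v' ^ 2 * f) := mul_left_cancel₀ hf0 (by linear_combination h1)
    by_contra hv
    have hv' : v' ≠ 0 := right_ne_zero_of_mul hv
    refine hv' (ih _ ?_ h2 rfl)
    rw [← hn, natDegree_mul hf0 hv']
    omega

theorem eq_zero_and_eq_zero_of_X_pow_dvd {f u v : E[X]} (hf : Squarefree f) (hdeg : 0 < f.natDegree)
    (h0 : f.eval 0 ≠ 0) (p : ℕ) [Fact p.Prime] [CharP E p] (k : ℕ) (hodd : Odd (p ^ k)) {A : ℕ}
    (hA : 2 * A + f.natDegree ≤ p ^ k) (hu : u ∈ degreeLT E A) (hv : v ∈ degreeLT E A)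
    (h : X ^ (p ^ k) ∣ u + v * f ^ ((p ^ k + 1) / 2)) : u = 0 ∧ v = 0 := by
  have hcong : X ^ (p ^ k) ∣ f ^ (p ^ k) - C (f.eval 0 ^ (p ^ k)) := by
    have h1 : X ∣ f - C (f.eval 0) := by
      have := X_sub_C_dvd_sub_C_eval (a := (0 : E)) (p := f)
      simpa using this
    have h2 := pow_dvd_pow_of_dvd h1 (p ^ k)
    rwa [sub_pow_char_pow, ← C_pow] at h2
  have hr : (p ^ k + 1) / 2 * 2 = p ^ k + 1 := by
    obtain ⟨m, hm⟩ := hodd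
    omega
  have hsq : X ^ (p ^ k) ∣ u ^ 2 - C (f.eval 0 ^ (p ^ k)) * (v ^ 2 * f) := by
    have h3 : u ^ 2 - C (f.eval 0 ^ (p ^ k)) * (v ^ 2 * f)
        = (u + v * f ^ ((p ^ k + 1) / 2)) * (u - v * f ^ ((p ^ k + 1) / 2))
          + v ^ 2 * f * (f ^ (p ^ k) - C (f.eval 0 ^ (p ^ k))) := by
      have : (f ^ ((p ^ k + 1) / 2)) ^ 2 = f ^ (p ^ k) * f := by
        rw [← pow_mul, hr, pow_succ]
      linear_combination v ^ 2 * this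
    rw [h3]
    exact dvd_add (dvd_mul_of_dvd_left h _) (dvd_mul_of_dvd_right hcong _)
  have hdu : ∀ w ∈ degreeLT E A, w ≠ 0 → w.natDegree < A := fun w hw hw0 => by
    rw [mem_degreeLT] at hw
    exact (natDegree_lt_iff_degree_lt hw0).mpr hw
  have hzero : u ^ 2 - C (f.eval 0 ^ (p ^ k)) * (v ^ 2 * f) = 0 := by
    refine eq_zero_of_dvd_of_degree_lt hsq ?_
    rw [degree_X_pow]
    have hbound : ∀ w ∈ degreeLT E A, ∀ g : E[X], g.natDegree ≤ f.natDegree →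
        (w ^ 2 * g).degree < (p ^ k : ℕ) := by
      intro w hw g hg
      by_cases hw0 : w = 0
      · rw [hw0, zero_pow two_ne_zero, zero_mul, degree_zero]
        exact WithBot.bot_lt_coe _
      have := hdu w hw hw0
      refine (degree_le_natDegree).trans_lt ?_
      rw [Nat.cast_lt]
      have h4 := natDegree_mul_le (p := w ^ 2) (q := g)
      have h5 := natDegree_pow_le (p := w) (n := 2)
      omega
    refine (degree_sub_le _ _).trans_lt (max_lt ?_ ?_)
    · simpa using hbound u hu 1 (by simp)
    · refine lt_of_le_of_lt ?_ (hbound v hv f le_rfl)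
      exact (degree_C_mul (pow_ne_zero _ h0)).le
  have hv0 : v = 0 :=
    eq_zero_of_sq_eq_C_mul_sq_mul_squarefree hf hdeg (pow_ne_zero (p ^ k) h0) (sub_eq_zero.mp hzero)
  refine ⟨?_, hv0⟩
  rw [hv0] at hzero
  simpa using hzero

theorem eq_zero_of_sum_mul_X_pow_eq_zero {r : ℕ} (P : E[X] → Prop)
    (hP : ∀ w, P w → X ^ r ∣ w → w = 0) (J : ℕ) (w : ℕ → E[X]) (hw : ∀ j, P (w j))
    (h : ∑ j ∈ Finset.range J, w j * X ^ (r * j) = 0) : ∀ j < J, w j = 0 := by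
  induction J generalizing w with
  | zero => intro j hj; omega
  | succ J ih =>
    rw [Finset.sum_range_succ'] at h
    have hs : ∑ j ∈ Finset.range J, w (j + 1) * X ^ (r * (j + 1))
        = X ^ r * ∑ j ∈ Finset.range J, w (j + 1) * X ^ (r * j) := by
      rw [Finset.mul_sum]
      refine Finset.sum_congr rfl fun j _ => ?_
      ring
    rw [hs] at h
    have h0 : w 0 = 0 := by
      refine hP _ (hw 0) ?_
      refine ⟨-∑ j ∈ Finset.range J, w (j + 1) * X ^ (r * j), ?_⟩
      simp only [mul_zero, pow_zero, mul_one] at h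
      linear_combination h
    rw [h0, zero_mul, add_zero, mul_eq_zero] at h
    have h1 := ih (fun j => w (j + 1)) (fun j => hw _) (h.resolve_left (pow_ne_zero _ X_ne_zero))
    intro j hj
    cases j with
    | zero => exact h0
    | succ j => exact h1 j (by omega)

/-- The auxiliary polynomial obtained by reducing `X ^ (r ^ 2)` to `X` and `f ^ ((r ^ 2 - 1) / 2)`
to `-1` in the `r`-th power of `stepanovPolynomial`. -/
noncomputable def stepanovReduction (f : E[X]) (r J : ℕ) (u v : ℕ → E[X]) : E[X] :=
  ∑ j ∈ Finset.range J, (u j ^ r - v j ^ r * f ^ ((r + 1) / 2)) * X ^ j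

/-- Stepanov's auxiliary polynomial for the values `z` with `f(z) ^ ((r ^ 2 - 1) / 2) = -1`. -/
noncomputable def stepanovPolynomial (f : E[X]) (r J : ℕ) (u v : ℕ → E[X]) : E[X] :=
  ∑ j ∈ Finset.range J, (u j + v j * f ^ ((r + 1) / 2)) * X ^ (r * j)

theorem eval_stepanovPolynomial_pow [Fintype E] (f : E[X]) (p : ℕ) [Fact p.Prime] [CharP E p]
    (k : ℕ) (hodd : Odd (p ^ k)) (hcard : Fintype.card E = (p ^ k) ^ 2) (J : ℕ) (u v : ℕ → E[X])
    {z : E} (hz : f.eval z ^ (((p ^ k) ^ 2 - 1) / 2) = -1) :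
    (stepanovPolynomial f (p ^ k) J u v).eval z ^ (p ^ k)
      = (stepanovReduction f (p ^ k) J u v).eval z := by
  simp only [stepanovPolynomial, stepanovReduction, eval_finsetSum]
  rw [sum_pow_char_pow]
  refine Finset.sum_congr rfl fun j _ => ?_
  have h1 : (z ^ (p ^ k * j)) ^ (p ^ k) = z ^ j := by
    rw [← pow_mul, mul_right_comm, ← sq, ← hcard, pow_mul, FiniteField.pow_card]
  have h2 : (f.eval z ^ ((p ^ k + 1) / 2)) ^ (p ^ k) = - f.eval z ^ ((p ^ k + 1) / 2) := by
    obtain ⟨m, hm⟩ := hodd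
    rw [hm] at hz ⊢
    rw [← pow_mul]
    have e1 : (2 * m + 1 + 1) / 2 = m + 1 := by omega
    have e2 : ((2 * m + 1) ^ 2 - 1) / 2 = 2 * m * (m + 1) := by
      have : (2 * m + 1) ^ 2 = 2 * (2 * m * (m + 1)) + 1 := by ring
      omega
    rw [e1]
    rw [e2] at hz
    rw [show (m + 1) * (2 * m + 1) = 2 * m * (m + 1) + (m + 1) by ring, pow_add, hz]
    ring
  simp only [eval_mul, eval_add, eval_sub, eval_pow, eval_X]
  rw [mul_pow, h1, add_pow_char_pow, mul_pow, h2]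
  ring

theorem stepanovReduction_mem_degreeLT {f : E[X]} {r J A : ℕ} {u v : ℕ → E[X]}
    (hu : ∀ j, u j ∈ degreeLT E A) (hv : ∀ j, v j ∈ degreeLT E A) :
    stepanovReduction f r J u v ∈ degreeLT E (r * A + (r + 1) / 2 * f.natDegree + J) := by
  have hd : ∀ w ∈ degreeLT E A, w.natDegree ≤ A := fun w hw =>
    natDegree_le_of_degree_le (mem_degreeLT.mp hw).le
  refine Submodule.sum_mem _ fun j hj => ?_
  rw [Finset.mem_range] at hj
  rw [mem_degreeLT]
  refine degree_le_natDegree.trans_lt ?_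
  rw [Nat.cast_lt]
  have h1 : (u j ^ r).natDegree ≤ r * A :=
    natDegree_pow_le.trans (Nat.mul_le_mul_left _ (hd _ (hu j)))
  have h2 : (v j ^ r * f ^ ((r + 1) / 2)).natDegree ≤ r * A + (r + 1) / 2 * f.natDegree :=
    natDegree_mul_le.trans (add_le_add
      (natDegree_pow_le.trans (Nat.mul_le_mul_left _ (hd _ (hv j)))) natDegree_pow_le)
  have h3 := natDegree_sub_le (u j ^ r) (v j ^ r * f ^ ((r + 1) / 2))
  have h4 := natDegree_mul_le (p := u j ^ r - v j ^ r * f ^ ((r + 1) / 2)) (q := X ^ j)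
  rw [natDegree_X_pow] at h4
  have h5 := max_le (h1.trans (Nat.le_add_right _ _)) h2
  omega

theorem natDegree_stepanovPolynomial_le {f : E[X]} {r J A : ℕ} {u v : ℕ → E[X]}
    (hu : ∀ j, u j ∈ degreeLT E A) (hv : ∀ j, v j ∈ degreeLT E A) :
    (stepanovPolynomial f r J u v).natDegree ≤ A + (r + 1) / 2 * f.natDegree + r * (J - 1) := by
  have hd : ∀ w ∈ degreeLT E A, w.natDegree ≤ A := fun w hw =>
    natDegree_le_of_degree_le (mem_degreeLT.mp hw).le
  refine natDegree_sum_le_of_forall_le _ _ fun j hj => ?_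
  rw [Finset.mem_range] at hj
  have h2 : (v j * f ^ ((r + 1) / 2)).natDegree ≤ A + (r + 1) / 2 * f.natDegree :=
    natDegree_mul_le.trans (add_le_add (hd _ (hv j)) natDegree_pow_le)
  refine natDegree_mul_le.trans (add_le_add ((natDegree_add_le _ _).trans
    (max_le ((hd _ (hu j)).trans (Nat.le_add_right _ _)) h2)) ?_)
  rw [natDegree_X_pow]
  exact Nat.mul_le_mul_left _ (by omega)

theorem exists_stepanovReduction_eq_zero [Fintype E] (f : E[X]) (p : ℕ) [Fact p.Prime] [CharP E p]
    (k J A : ℕ) (hN : p ^ k * A + (p ^ k + 1) / 2 * f.natDegree + J < 2 * (A * J)) :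
    ∃ u v : ℕ → E[X], (∀ j, u j ∈ degreeLT E A) ∧ (∀ j, v j ∈ degreeLT E A) ∧
      (∃ j < J, ¬ (u j = 0 ∧ v j = 0)) ∧ stepanovReduction f (p ^ k) J u v = 0 := by
  classical
  set N := p ^ k * A + (p ^ k + 1) / 2 * f.natDegree + J with hNdef
  have hcard : ∀ n, Nat.card (degreeLT E n) = Nat.card E ^ n := fun n => by
    rw [Nat.card_congr (degreeLTEquiv E n).toEquiv, Nat.card_fun, Nat.card_fin]
  have hfin : ∀ n, Finite (degreeLT E n) := fun n => Finite.of_equiv _ (degreeLTEquiv E n).toEquiv.symm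
  let ext : (Fin J → degreeLT E A) → ℕ → E[X] := fun w j => if h : j < J then (w ⟨j, h⟩ : E[X]) else 0
  have hext : ∀ w j, ext w j ∈ degreeLT E A := by
    intro w j
    simp only [ext]
    split_ifs
    · exact (w _).2
    · exact Submodule.zero_mem _
  let Φ : (Fin J → degreeLT E A) × (Fin J → degreeLT E A) → degreeLT E N := fun w =>
    ⟨stepanovReduction f (p ^ k) J (ext w.1) (ext w.2),
      stepanovReduction_mem_degreeLT (hext _) (hext _)⟩
  have hnot : ¬ Function.Injective Φ := by
    intro hinj
    have h1 := Nat.card_le_card_of_injective Φ hinj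
    rw [Nat.card_prod, Nat.card_fun, Nat.card_fin, hcard, hcard, ← pow_mul, ← pow_add,
      ← two_mul] at h1
    have h2 : 1 < Nat.card E := Finite.one_lt_card
    exact absurd ((Nat.pow_le_pow_iff_right h2).mp h1) (by omega)
  rw [Function.Injective] at hnot
  push Not at hnot
  obtain ⟨⟨u, v⟩, ⟨u', v'⟩, heq, hne⟩ := hnot
  refine ⟨fun j => ext u j - ext u' j, fun j => ext v j - ext v' j,
    fun j => Submodule.sub_mem _ (hext _ _) (hext _ _),
    fun j => Submodule.sub_mem _ (hext _ _) (hext _ _), ?_, ?_⟩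
  · by_contra hall
    push Not at hall
    apply hne
    have hall' := fun j : Fin J => hall j j.2
    simp only [ext, Fin.is_lt, dif_pos, Fin.eta, sub_eq_zero] at hall'
    ext j : 2
    · exact Subtype.ext (hall' j).1
    · exact Subtype.ext (hall' j).2
  · have h1 : stepanovReduction f (p ^ k) J (ext u) (ext v)
        = stepanovReduction f (p ^ k) J (ext u') (ext v') := congrArg Subtype.val heq
    rw [← sub_eq_zero] at h1
    rw [← h1]
    simp only [stepanovReduction, ← Finset.sum_sub_distrib]
    refine Finset.sum_congr rfl fun j _ => ?_
    rw [sub_pow_char_pow, sub_pow_char_pow]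
    ring

theorem two_mul_card_pow_eq_neg_one_le [Fintype E] [DecidableEq E] {f : E[X]} (hf : Squarefree f)
    (hdeg : 0 < f.natDegree) (h0 : f.eval 0 ≠ 0) (p : ℕ) [Fact p.Prime] [CharP E p] (k : ℕ)
    (hodd : Odd (p ^ k)) (hcard : Fintype.card E = (p ^ k) ^ 2) :
    2 * (Finset.univ.filter fun z : E => f.eval z ^ (((p ^ k) ^ 2 - 1) / 2) = -1).card
      ≤ (p ^ k) ^ 2 + (8 * f.natDegree + 8) * p ^ k := by
  set m := f.natDegree with hm
  set r := p ^ k with hr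
  by_cases hlarge : r < 3 * (m + 1)
  · have h1 := Finset.card_le_univ
      (Finset.univ.filter fun z : E => f.eval z ^ ((r ^ 2 - 1) / 2) = -1)
    rw [hcard] at h1
    nlinarith
  push Not at hlarge
  obtain ⟨h, hh⟩ : ∃ h, 2 * h = r + 1 := by
    obtain ⟨a, ha⟩ := hodd
    exact ⟨a + 1, by omega⟩
  have hh' : (r + 1) / 2 = h := by omega
  obtain ⟨A, hA1, hA2⟩ : ∃ A, 2 * A + m ≤ r ∧ r ≤ 2 * A + m + 1 := ⟨(r - m) / 2, by omega, by omega⟩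
  set J := h + 3 * (m + 1) with hJ
  have hN : r * A + (r + 1) / 2 * m + J < 2 * (A * J) := by
    rw [hh', hJ]
    have h3A : r ≤ 3 * A := by omega
    have e1 : 2 * (A * (h + 3 * (m + 1))) = A * (2 * h) + 2 * ((m + 1) * (3 * A)) := by ring
    have e2 : (m + 1) * r ≤ (m + 1) * (3 * A) := Nat.mul_le_mul_left _ h3A
    rw [e1, hh]
    nlinarith
  obtain ⟨u, v, hu, hv, ⟨j, hj, hne⟩, hred⟩ := exists_stepanovReduction_eq_zero f p k J A hN
  have hS : stepanovPolynomial f r J u v ≠ 0 := by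
    intro hS0
    have key : ∀ j, X ^ r ∣ u j + v j * f ^ ((r + 1) / 2) → u j = 0 ∧ v j = 0 := fun j hj =>
      eq_zero_and_eq_zero_of_X_pow_dvd hf hdeg h0 p k hodd hA1 (hu j) (hv j) hj
    have := eq_zero_of_sum_mul_X_pow_eq_zero
      (fun w => ∃ j, w = u j + v j * f ^ ((r + 1) / 2))
      (by
        rintro w ⟨j, rfl⟩ hj
        rw [(key j hj).1, (key j hj).2]
        simp) J _ (fun j => ⟨j, rfl⟩) hS0 j hj
    exact hne (key j (this ▸ dvd_zero _))
  have hsub : (Finset.univ.filter fun z : E => f.eval z ^ ((r ^ 2 - 1) / 2) = -1)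
      ⊆ (stepanovPolynomial f r J u v).roots.toFinset := by
    intro z hz
    rw [Finset.mem_filter] at hz
    rw [Multiset.mem_toFinset, mem_roots hS, IsRoot.def]
    have h1 := eval_stepanovPolynomial_pow f p k hodd hcard J u v hz.2
    rw [hred, eval_zero] at h1
    exact eq_zero_of_pow_eq_zero h1
  have h2 := (Finset.card_le_card hsub).trans ((Multiset.toFinset_card_le _).trans
    ((card_roots' _).trans (natDegree_stepanovPolynomial_le hu hv)))
  rw [hh', ← hm] at h2
  refine (Nat.mul_le_mul_left 2 h2).trans ?_
  obtain ⟨J', hJ'⟩ : ∃ J', J = J' + 1 := ⟨h + 3 * m + 2, by omega⟩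
  have h3 : J - 1 = J' := by omega
  rw [h3]
  have h4 : 2 * J' = r + 6 * m + 5 := by omega
  have h5 : 2 * (A + h * m + r * J') = 2 * A + (2 * h) * m + r * (2 * J') := by ring
  rw [h5, hh, h4]
  nlinarith

end Stepanov

section ArtinSchreier

open Polynomial

variable {E : Type u} [Field E]

/-- The discriminant of `x ^ 2 - (z ^ q - z) * x + a`, as a polynomial in `z`. -/
noncomputable def artinSchreierDiscr (q : ℕ) (a : E) : E[X] := (X ^ q - X) ^ 2 - C (4 * a)

theorem natDegree_artinSchreierDiscr {q : ℕ} (hq : 1 < q) (a : E) :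
    (artinSchreierDiscr q a).natDegree = 2 * q := by
  have h1 : (X ^ q - X : E[X]).natDegree = q := FiniteField.X_pow_card_sub_X_natDegree_eq E hq
  rw [artinSchreierDiscr, natDegree_sub_C, natDegree_pow, h1]

theorem squarefree_artinSchreierDiscr {q : ℕ} (hq : (q : E) = 0) {a : E} (ha : a ≠ 0)
    (h2 : (2 : E) ≠ 0) : Squarefree (artinSchreierDiscr q a) := by
  apply Separable.squarefree
  have hd : derivative (artinSchreierDiscr q a) = -(C 2 * (X ^ q - X)) := by
    simp [artinSchreierDiscr, derivative_pow, hq]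
  rw [Separable, hd]
  refine ⟨C (-(4 * a)⁻¹), C (-(4 * a)⁻¹) * C 2⁻¹ * (X ^ q - X), ?_⟩
  have e1 : (C (4 * a)⁻¹ : E[X]) * C (4 * a) = 1 := by
    rw [← C_mul, inv_mul_cancel₀, C_1]
    have : (4 : E) = 2 * 2 := by norm_num
    rw [this]
    positivity
  have e2 : (C 2⁻¹ : E[X]) * C 2 = 1 := by rw [← C_mul, inv_mul_cancel₀ h2, C_1]
  rw [artinSchreierDiscr, C_neg]
  linear_combination e1 + C (4 * a)⁻¹ * (X ^ q - X) ^ 2 * e2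

theorem eval_artinSchreierDiscr (q : ℕ) (a z : E) :
    (artinSchreierDiscr q a).eval z = (z ^ q - z) ^ 2 - 4 * a := by
  simp [artinSchreierDiscr]

theorem two_le_card_add_div_eq [Fintype E] [DecidableEq E] (h2 : (2 : E) ≠ 0) {a y w : E}
    (ha : a ≠ 0) (hw0 : w ≠ 0) (hw : y ^ 2 - 4 * a = w ^ 2) :
    2 ≤ (Finset.univ.filter fun x : E => x ≠ 0 ∧ x + a / x = y).card := by
  have hne : (y + w) / 2 ≠ (y - w) / 2 := by
    intro h
    field_simp at h
    have : 2 * w = 0 := by linear_combination h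
    simp [h2, hw0] at this
  have hprod : (y + w) / 2 * ((y - w) / 2) = a := by
    field_simp
    linear_combination hw
  have hx1 : (y + w) / 2 ≠ 0 := fun h => ha (by rw [← hprod, h, zero_mul])
  have hx2 : (y - w) / 2 ≠ 0 := fun h => ha (by rw [← hprod, h, mul_zero])
  rw [← Finset.card_pair hne]
  refine Finset.card_le_card ?_
  have hsum : (y + w) / 2 + (y - w) / 2 = y := by field_simp; ring
  intro x hx
  simp only [Finset.mem_insert, Finset.mem_singleton] at hx
  simp only [Finset.mem_filter, Finset.mem_univ, true_and]
  rcases hx with rfl | rfl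
  · refine ⟨hx1, ?_⟩
    rw [← hprod, mul_div_cancel_left₀ _ hx1, hsum]
  · refine ⟨hx2, ?_⟩
    rw [← hprod, mul_div_cancel_right₀ _ hx2, add_comm, hsum]

theorem card_pow_sub_self_eq_le [Fintype E] [DecidableEq E] {q : ℕ} (hq : 1 < q) (y : E) :
    (Finset.univ.filter fun z : E => y = z ^ q - z).card ≤ q := by
  have h1 : (X ^ q - X - C y : E[X]).natDegree = q := by
    rw [natDegree_sub_C]
    exact FiniteField.X_pow_card_sub_X_natDegree_eq E hq
  have h0 : (X ^ q - X - C y : E[X]) ≠ 0 := by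
    intro h
    rw [h, natDegree_zero] at h1
    omega
  refine (Finset.card_le_card (t := (X ^ q - X - C y : E[X]).roots.toFinset) ?_).trans
    ((Multiset.toFinset_card_le _).trans ((card_roots' _).trans h1.le))
  intro z hz
  rw [Finset.mem_filter] at hz
  rw [Multiset.mem_toFinset, mem_roots h0, IsRoot.def, eval_sub, eval_sub, eval_pow, eval_X, eval_C,
    sub_eq_zero]
  exact hz.2.symm

theorem le_mul_card_trace_eq_zero [Fintype E] [DecidableEq E] {F : Type*} [AddCommGroup F]
    [DecidableEq F]
    (p : ℕ) [Fact p.Prime] [CharP E p] (hp2 : p ≠ 2) (k : ℕ)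
    (hcard : Fintype.card E = (p ^ k) ^ 2) {q : ℕ} (hq1 : 1 < q) (hq : (q : E) = 0)
    (T : E →+ F) (hT : ∀ z, T (z ^ q) = T z) {a : E} (ha : a ≠ 0) :
    Fintype.card E ≤
      q * (Finset.univ.filter fun x : E => x ≠ 0 ∧ T (x + a / x) = 0).card
        + (20 * q + 8) * p ^ k := by
  have hring : ringChar E ≠ 2 := by rwa [ringChar.eq E p]
  have h2 : (2 : E) ≠ 0 := Ring.two_ne_zero hring
  have hodd : Odd (p ^ k) := ((Fact.out : p.Prime).odd_of_ne_two hp2).pow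
  set X₀ := Finset.univ.filter fun x : E => x ≠ 0 ∧ T (x + a / x) = 0 with hX₀
  set f := artinSchreierDiscr q a with hf
  have hdeg : f.natDegree = 2 * q := natDegree_artinSchreierDiscr hq1 a
  have hf0 : f ≠ 0 := fun h => by rw [h, natDegree_zero] at hdeg; omega
  set B := Finset.univ.filter fun z : E => f.eval z ^ (((p ^ k) ^ 2 - 1) / 2) = -1 with hB
  set Z := Finset.univ.filter fun z : E => f.eval z = 0 with hZ
  have hBcard : 2 * B.card ≤ (p ^ k) ^ 2 + (8 * f.natDegree + 8) * p ^ k := by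
    refine two_mul_card_pow_eq_neg_one_le (f := f) (squarefree_artinSchreierDiscr hq ha h2)
      (by omega) ?_ p k
      hodd hcard
    rw [eval_artinSchreierDiscr, zero_pow (by omega)]
    have : (4 : E) = 2 * 2 := by norm_num
    simp [this, h2, ha]
  have hZcard : Z.card ≤ 2 * q := by
    rw [← hdeg]
    refine (Finset.card_le_card (t := f.roots.toFinset) ?_).trans
      ((Multiset.toFinset_card_le _).trans (card_roots' _))
    intro z hz
    rw [Multiset.mem_toFinset, mem_roots hf0]
    exact (Finset.mem_filter.mp hz).2
  have hdouble := Finset.sum_card_bipartiteAbove_eq_sum_card_bipartiteBelow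
    (s := X₀) (t := (Finset.univ : Finset E)) (fun x z => x + a / x = z ^ q - z)
  have hupper : ∑ x ∈ X₀, ((Finset.univ : Finset E).bipartiteAbove
      (fun x z => x + a / x = z ^ q - z) x).card ≤ q * X₀.card := by
    rw [mul_comm, ← smul_eq_mul]
    exact Finset.sum_le_card_nsmul _ _ _ fun x _ => card_pow_sub_self_eq_le hq1 _
  have hlower : 2 * ((B ∪ Z)ᶜ).card ≤ ∑ z : E, (X₀.bipartiteBelow
      (fun x z => x + a / x = z ^ q - z) z).card := by
    rw [mul_comm, ← smul_eq_mul]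
    refine le_trans (Finset.card_nsmul_le_sum _ _ 2 fun z hz => ?_)
      (Finset.sum_le_sum_of_subset (Finset.subset_univ ((B ∪ Z)ᶜ)))
    simp only [hB, hZ, Finset.mem_compl, Finset.mem_union, Finset.mem_filter, Finset.mem_univ,
      true_and, not_or] at hz
    have hpow : f.eval z ^ (Fintype.card E / 2) = 1 := by
      have hhalf : Fintype.card E / 2 = ((p ^ k) ^ 2 - 1) / 2 := by
        rw [hcard]
        obtain ⟨m, hm⟩ := hodd.pow (n := 2)
        omega
      exact (FiniteField.pow_dichotomy hring hz.2).resolve_right (by rw [hhalf]; exact hz.1)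
    obtain ⟨w, hw⟩ := (FiniteField.isSquare_iff hring hz.2).mpr hpow
    have hw0 : w ≠ 0 := by rintro rfl; exact hz.2 (by rw [hw, zero_mul])
    rw [eval_artinSchreierDiscr, ← sq] at hw
    refine (two_le_card_add_div_eq h2 ha hw0 hw).trans (Finset.card_le_card ?_)
    intro x hx
    simp only [Finset.mem_filter, Finset.mem_univ, true_and] at hx
    simp only [Finset.bipartiteBelow, hX₀, Finset.mem_filter, Finset.mem_univ, true_and]
    refine ⟨⟨hx.1, ?_⟩, hx.2⟩
    rw [hx.2, map_sub, hT, sub_self]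
  have hcompl := Finset.card_compl_add_card (B ∪ Z)
  have hunion := Finset.card_union_le B Z
  have hpos : 1 ≤ p ^ k := hodd.pos
  rw [hdeg] at hBcard
  rw [← hdouble] at hlower
  have h4q : 4 * q ≤ 4 * q * p ^ k := Nat.le_mul_of_pos_right _ hpos
  have e1 : (8 * (2 * q) + 8) * p ^ k + 4 * q * p ^ k = (20 * q + 8) * p ^ k := by ring
  rw [← hcard] at hBcard
  omega

end ArtinSchreier

section Tower

/-- The iterates `x ↦ x ^ 2 - 2 * q ^ (2 ^ k)`, sending `a + b` with `a * b = q` to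
`a ^ (2 ^ k) + b ^ (2 ^ k)`. -/
def powerSumIter {R : Type*} [CommRing R] (q x : R) : ℕ → R
  | 0 => x
  | k + 1 => powerSumIter q x k ^ 2 - 2 * q ^ (2 ^ k)

theorem quadraticTrace_pow {F : Type u} [Field F] (p : ℕ) [Fact p.Prime] [CharP F p] {d : F}
    (n : ℕ) (hodd : Odd (p ^ n)) (z : QuadraticAlgebra F d 0) :
    quadraticTrace d (z ^ (p ^ n)) = quadraticTrace d z ^ (p ^ n) := by
  have : CharP (QuadraticAlgebra F d 0) p :=
    charP_of_injective_algebraMap QuadraticAlgebra.algebraMap_injective p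
  have hω : ∀ m : ℕ, ((⟨0, 1⟩ : QuadraticAlgebra F d 0) ^ (2 * m + 1)).re = 0 := by
    intro m
    have h1 : (⟨0, 1⟩ : QuadraticAlgebra F d 0) ^ 2 = algebraMap F _ d := by
      rw [sq]
      ext <;> simp
    rw [pow_succ, pow_mul, h1, ← map_pow]
    simp [-map_pow]
  have hz : z = algebraMap F _ z.re + algebraMap F _ z.im * ⟨0, 1⟩ := by
    ext <;> simp
  obtain ⟨m, hm⟩ := hodd
  have hre : (z ^ (p ^ n)).re = z.re ^ (p ^ n) := by
    conv_lhs => rw [hz]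
    rw [add_pow_char_pow, mul_pow, ← map_pow, ← map_pow]
    have := hω m
    rw [← hm] at this
    simp [-map_pow, this]
  simp only [quadraticTrace, AddMonoidHom.coe_mk, ZeroHom.coe_mk, hre]
  rw [two_mul, two_mul, add_pow_char_pow]

theorem compAddMonoidHom_ne_one {A B : Type*} [AddGroup A] [AddGroup B] {ψ : AddChar B ℂ}
    (hψ : ψ ≠ 1) {T : A →+ B} (hT : Function.Surjective T) : ψ.compAddMonoidHom T ≠ 1 := by
  rw [AddChar.ne_one_iff] at hψ ⊢
  obtain ⟨b, hb⟩ := hψ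
  obtain ⟨a, rfl⟩ := hT b
  exact ⟨a, hb⟩

theorem exists_tower {F : Type u} [Field F] [Fintype F] [DecidableEq F] (p : ℕ) [Fact p.Prime]
    [CharP F p] (hp2 : p ≠ 2) (k : ℕ) :
    ∃ (E : Type u) (_ : Field E) (_ : Fintype E) (_ : DecidableEq E) (_ : CharP E p) (i : F →+* E)
      (T : E →+ F), Fintype.card E = Fintype.card F ^ (2 ^ k) ∧ Function.Surjective T ∧
      (∀ z, T (z ^ Fintype.card F) = T z) ∧
      ∀ ψ : AddChar F ℂ, ψ ≠ 1 → ∀ α : Fˣ,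
        kloostermanSum (ψ.compAddMonoidHom T) (Units.map i.toMonoidHom α)
          = powerSumIter (Fintype.card F : ℂ) (kloostermanSum ψ α) k := by
  induction k with
  | zero =>
    refine ⟨F, inferInstance, inferInstance, inferInstance, inferInstance, RingHom.id F,
      AddMonoidHom.id F, by simp, Function.surjective_id, fun z => ?_, fun ψ _ α => ?_⟩
    · rw [FiniteField.pow_card]
    · rfl
  | succ k ih =>
    obtain ⟨E, _, _, _, _, i, T, hcard, hsurj, hfrob, hkl⟩ := ih
    have hring : ringChar E ≠ 2 := by rwa [ringChar.eq E p]
    have h2 : (2 : E) ≠ 0 := Ring.two_ne_zero hring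
    obtain ⟨d, hd⟩ := FiniteField.exists_nonsquare hring
    have : Fact (∀ r : E, r ^ 2 ≠ d + 0 * r) := ⟨fun r hr => hd ⟨r, by rw [← sq, hr]; ring⟩⟩
    classical
    refine ⟨QuadraticAlgebra E d 0, inferInstance, inferInstance, inferInstance,
      charP_of_injective_algebraMap QuadraticAlgebra.algebraMap_injective p,
      (algebraMap E _).comp i, T.comp (quadraticTrace d), ?_, ?_, ?_, ?_⟩
    · rw [card_quadraticAlgebra, hcard, ← pow_mul, pow_succ]
    · refine hsurj.comp fun y => ⟨⟨y / 2, 0⟩, ?_⟩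
      simp [quadraticTrace, mul_div_cancel₀ _ h2]
    · intro z
      obtain ⟨n, -, hn⟩ := FiniteField.card F p
      have := quadraticTrace_pow p n (((Fact.out : p.Prime).odd_of_ne_two hp2).pow) z
      rw [AddMonoidHom.comp_apply, AddMonoidHom.comp_apply, hn, this, ← hn, hfrob]
    · intro ψ hψ α
      have h1 := kloostermanSum_quadraticAlgebra_eq_sq_sub (d := d) hring
        (ψ.compAddMonoidHom T) (compAddMonoidHom_ne_one hψ hsurj) (Units.map i.toMonoidHom α)
      rw [hkl ψ hψ α, hcard] at h1
      rw [powerSumIter]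
      push_cast at h1
      exact h1

end Tower

section WeilBound

theorem powerSumIter_ofReal (q x : ℝ) (k : ℕ) :
    ((powerSumIter q x k : ℝ) : ℂ) = powerSumIter (q : ℂ) (x : ℂ) k := by
  induction k with
  | zero => rfl
  | succ k ih => rw [powerSumIter, powerSumIter, ← ih]; push_cast; rfl

theorem neg_two_mul_le_powerSumIter (q x : ℝ) (k : ℕ) :
    -(2 * q ^ (2 ^ k)) ≤ powerSumIter q x (k + 1) := by
  rw [powerSumIter]
  nlinarith [sq_nonneg (powerSumIter q x k)]

theorem le_powerSumIter {q x δ : ℝ} (hq : 0 ≤ q) (hδ : 0 ≤ δ) (hx : (4 + δ) * q ≤ x ^ 2) (k : ℕ) :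
    (2 + 4 ^ k * δ) * q ^ (2 ^ k) ≤ powerSumIter q x (k + 1) := by
  induction k with
  | zero =>
    simp only [powerSumIter, pow_zero, pow_one, one_mul]
    linarith
  | succ k ih =>
    rw [powerSumIter]
    have hQ : 0 ≤ q ^ (2 ^ k) := by positivity
    have e : q ^ (2 ^ (k + 1)) = (q ^ (2 ^ k)) ^ 2 := by rw [← pow_mul, pow_succ]
    have h4 : (0 : ℝ) ≤ 4 ^ k * δ := by positivity
    have h1 := pow_le_pow_left₀ (by positivity) ih 2
    rw [e, pow_succ (4 : ℝ)]
    nlinarith [mul_nonneg (sq_nonneg (4 ^ k * δ)) (sq_nonneg (q ^ (2 ^ k)))]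

variable {F : Type u} [Field F] [Fintype F] [DecidableEq F]

open AddChar in
theorem sum_kloostermanSum_comp {E : Type u} [Field E] [Fintype E] [DecidableEq E] (T : E →+ F)
    (a : Eˣ) : ∑ ψ : AddChar F ℂ, kloostermanSum (ψ.compAddMonoidHom T) a
      = -((Fintype.card F * (Finset.univ.filter fun x : E =>
          x ≠ 0 ∧ T (x + a / x) = 0).card : ℕ) : ℂ) := by
  simp_rw [kloostermanSum_eq_neg_sum_ite]
  rw [Finset.sum_neg_distrib, Finset.sum_comm, Finset.card_filter]
  push_cast
  rw [Finset.mul_sum]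
  congr 1
  refine Finset.sum_congr rfl fun x _ => ?_
  by_cases hx : x = 0
  · simp [hx]
  · have h : ∑ ψ : AddChar F ℂ, (ψ.compAddMonoidHom T) (x + a / x)
        = if T (x + a / x) = 0 then (Fintype.card F : ℂ) else 0 := sum_apply_eq_ite _
    simp only [hx, if_false, not_false_eq_true, ne_eq, true_and, mul_ite, mul_one, mul_zero]
    exact h

theorem kloostermanSum_one (α : Fˣ) :
    kloostermanSum (1 : AddChar F ℂ) α = -(Fintype.card F - 1 : ℂ) := by
  have h := Fintype.card_pos (α := F)
  simp [kloostermanSum, Fintype.card_units, Nat.cast_sub h]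

theorem sum_powerSumIter_kloostermanSum_le (p : ℕ) [Fact p.Prime] [CharP F p] (hp2 : p ≠ 2)
    (α : Fˣ) (k : ℕ) :
    ∑ ψ ∈ (Finset.univ : Finset (AddChar F ℂ)).erase 1,
        powerSumIter (Fintype.card F : ℝ) (kloostermanSum ψ α).re (k + 1)
      ≤ (20 * Fintype.card F + 8) * (Fintype.card F : ℝ) ^ (2 ^ k) := by
  obtain ⟨E, _, _, _, _, i, T, hcard, hsurj, hfrob, hkl⟩ :=
    exists_tower (F := F) p hp2 (k + 1)
  obtain ⟨⟨n, hn0⟩, -, hn⟩ := FiniteField.card F p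
  rw [PNat.mk_coe] at hn
  have hcard' : Fintype.card E = (p ^ (n * 2 ^ k)) ^ 2 := by
    rw [hcard, hn, pow_succ 2 k]
    ring
  have hq0 : (Fintype.card F : E) = 0 := by
    rw [hn, Nat.cast_pow, CharP.cast_eq_zero, zero_pow hn0.ne']
  set a := Units.map i.toMonoidHom α with ha
  have hmain := le_mul_card_trace_eq_zero p hp2 (n * 2 ^ k) hcard'
    (Fintype.one_lt_card (α := F)) hq0 T hfrob a.ne_zero
  have hsum := sum_kloostermanSum_comp T a
  rw [← Finset.add_sum_erase _ _ (Finset.mem_univ (1 : AddChar F ℂ))] at hsum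
  have h1 : (1 : AddChar F ℂ).compAddMonoidHom T = 1 := rfl
  rw [h1, kloostermanSum_one, Finset.sum_congr rfl (fun ψ hψ => by
    rw [hkl ψ (Finset.ne_of_mem_erase hψ) α, ← kloostermanSum_eq_ofReal_re ψ α,
      ← Complex.ofReal_natCast, ← powerSumIter_ofReal])] at hsum
  set X₀ := Finset.univ.filter fun x : E => x ≠ 0 ∧ T (x + a / x) = 0
  have hsum' : -((Fintype.card E : ℝ) - 1) +
      ∑ ψ ∈ (Finset.univ : Finset (AddChar F ℂ)).erase 1,
        powerSumIter (Fintype.card F : ℝ) (kloostermanSum ψ α).re (k + 1)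
      = -((Fintype.card F * X₀.card : ℕ) : ℝ) := by
    exact_mod_cast hsum
  have hpk : p ^ (n * 2 ^ k) = Fintype.card F ^ (2 ^ k) := by rw [hn, pow_mul]
  rw [hpk] at hmain
  have hmain' : (Fintype.card E : ℝ) ≤ ((Fintype.card F * X₀.card : ℕ) : ℝ)
      + (20 * Fintype.card F + 8) * (Fintype.card F : ℝ) ^ (2 ^ k) := by
    exact_mod_cast hmain
  linarith

theorem sq_re_kloostermanSum_le (p : ℕ) [Fact p.Prime] [CharP F p] (hp2 : p ≠ 2)
    (ψ : AddChar F ℂ) (hψ : ψ ≠ 1) (α : Fˣ) :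
    (kloostermanSum ψ α).re ^ 2 ≤ 4 * Fintype.card F := by
  by_contra! hlt
  set q : ℝ := (Fintype.card F : ℝ) with hq
  have hq0 : 0 < q := by rw [hq]; exact_mod_cast Fintype.card_pos
  obtain ⟨δ, hδ, hx⟩ : ∃ δ : ℝ, 0 < δ ∧ (4 + δ) * q ≤ (kloostermanSum ψ α).re ^ 2 := by
    refine ⟨(kloostermanSum ψ α).re ^ 2 / q - 4, ?_, ?_⟩
    · rw [sub_pos, lt_div_iff₀ hq0]; exact hlt
    · rw [add_sub_cancel, div_mul_cancel₀ _ hq0.ne']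
  obtain ⟨k, hk⟩ := pow_unbounded_of_one_lt ((22 * q + 8) / δ) (by norm_num : (1 : ℝ) < 4)
  rw [div_lt_iff₀ hδ] at hk
  have hQ : 0 < q ^ (2 ^ k) := by positivity
  have h1 := sum_powerSumIter_kloostermanSum_le p hp2 α k
  have hmem : ψ ∈ (Finset.univ : Finset (AddChar F ℂ)).erase 1 := by simp [hψ]
  rw [← Finset.add_sum_erase _ _ hmem] at h1
  have h2 := le_powerSumIter hq0.le hδ.le hx k
  have h3 : -((Fintype.card F : ℝ) * (2 * q ^ (2 ^ k))) ≤
      ∑ φ ∈ ((Finset.univ : Finset (AddChar F ℂ)).erase 1).erase ψ,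
        powerSumIter q (kloostermanSum φ α).re (k + 1) := by
    have h4 := Finset.card_nsmul_le_sum (((Finset.univ : Finset (AddChar F ℂ)).erase 1).erase ψ)
      (fun φ => powerSumIter q (kloostermanSum φ α).re (k + 1)) _
      (fun φ _ => neg_two_mul_le_powerSumIter q (kloostermanSum φ α).re k)
    refine le_trans ?_ h4
    rw [nsmul_eq_mul, mul_neg, neg_le_neg_iff]
    refine mul_le_mul_of_nonneg_right ?_ (by positivity)
    rw [← AddChar.card_eq (α := F)]
    exact_mod_cast Finset.card_le_univ _
  rw [← hq] at h1 h3
  nlinarith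

end WeilBound

section Arithmetic

variable {F : Type u} [Field F]

theorem addChar_pow_char_eq_one (p : ℕ) [CharP F p] (ψ : AddChar F ℂ) (x : F) : ψ x ^ p = 1 := by
  rw [← AddChar.map_nsmul_eq_pow, nsmul_eq_mul, CharP.cast_eq_zero, zero_mul,
    AddChar.map_zero_eq_one]

theorem isIntegral_addChar (p : ℕ) [Fact p.Prime] [CharP F p] (ψ : AddChar F ℂ) (x : F) :
    IsIntegral ℤ (ψ x) :=
  IsIntegral.of_pow (Fact.out : p.Prime).pos (by
    rw [addChar_pow_char_eq_one p]; exact isIntegral_one)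

theorem not_isUnit_natCast_integralClosure (p : ℕ) [hp : Fact p.Prime] :
    ¬ IsUnit ((p : ℕ) : integralClosure ℤ ℂ) := by
  intro h
  obtain ⟨b, hb⟩ := h.exists_right_inv
  have hb' : (p : ℂ) * b = 1 := by exact_mod_cast congrArg Subtype.val hb
  have hp0 : (p : ℂ) ≠ 0 := by exact_mod_cast hp.out.ne_zero
  have h1 : IsIntegral ℤ (algebraMap ℚ ℂ ((p : ℚ)⁻¹)) := by
    have h2 : algebraMap ℚ ℂ ((p : ℚ)⁻¹) = b := by
      rw [map_inv₀, map_natCast]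
      exact inv_eq_of_mul_eq_one_right hb'
    rw [h2]
    exact b.2
  rw [isIntegral_algebraMap_iff (algebraMap ℚ ℂ).injective] at h1
  obtain ⟨z, hz⟩ := IsIntegrallyClosed.isIntegral_iff.mp h1
  have hz' : (p : ℚ) * z = 1 := by
    have hp0' : (p : ℚ) ≠ 0 := by exact_mod_cast hp.out.ne_zero
    rw [eq_intCast] at hz
    rw [hz, mul_inv_cancel₀ hp0']
  have hz'' : (p : ℤ) * z = 1 := by exact_mod_cast hz'
  have := Int.isUnit_iff.mp (IsUnit.of_mul_eq_one _ hz'')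
  have h2 := hp.out.two_le
  omega

variable [Fintype F] [DecidableEq F]

theorem kloostermanSum_sq_ne (p : ℕ) [Fact p.Prime] [CharP F p] (ψ : AddChar F ℂ) (α : Fˣ) :
    kloostermanSum ψ α ^ 2 ≠ 4 * Fintype.card F := by
  intro h
  let R := integralClosure ℤ ℂ
  obtain ⟨M, hM, hpM⟩ := exists_max_ideal_of_mem_nonunits (not_isUnit_natCast_integralClosure p)
  let π := Ideal.Quotient.mk M
  have hp0 : ((p : ℕ) : R ⧸ M) = 0 := by
    have := Ideal.Quotient.eq_zero_iff_mem.mpr hpM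
    simpa using this
  have : CharP (R ⧸ M) p := (CharP.charP_iff_prime_eq_zero Fact.out).mpr hp0
  let w : F → R := fun x => ⟨ψ x, isIntegral_addChar p ψ x⟩
  have hw : ∀ x, π (w x) = 1 := by
    intro x
    have h1 : w x ^ p = 1 := Subtype.ext (addChar_pow_char_eq_one p ψ x)
    have h2 : (π (w x) - 1) ^ p = 0 := by
      rw [sub_pow_char, ← map_pow, h1, map_one, one_pow, sub_self]
    exact sub_eq_zero.mp (eq_zero_of_pow_eq_zero h2)
  obtain ⟨⟨n, hn0⟩, -, hn⟩ := FiniteField.card F p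
  have hq : ((Fintype.card F : ℕ) : R ⧸ M) = 0 := by
    rw [hn, Nat.cast_pow, hp0, PNat.mk_coe, zero_pow hn0.ne']
  have hK : (-∑ x : Fˣ, w ((x : F) + (α : F) / (x : F))) ^ 2
      = ((4 * Fintype.card F : ℕ) : R) := by
    apply Subtype.ext
    rw [kloostermanSum] at h
    rw [show (((4 * Fintype.card F : ℕ) : R) : ℂ) = ((4 * Fintype.card F : ℕ) : ℂ) from
      map_natCast R.val _]
    push_cast
    simpa [w] using h
  have h3 := congrArg π hK
  rw [map_pow, map_neg, map_sum, map_natCast, Nat.cast_mul, hq, mul_zero] at h3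
  simp only [hw, Finset.sum_const, Finset.card_univ, nsmul_eq_mul, mul_one, Fintype.card_units] at h3
  rw [Nat.cast_sub Fintype.card_pos, hq] at h3
  simp at h3

/-- The distance of a Kloosterman sum from the extreme values `±2 |F|^{1/2}` is bounded below
because the norm of a nonzero algebraic integer is at least `1`. -/
theorem one_le_four_mul_card_sub_sq_of_embedding (p : ℕ) [Fact p.Prime] [CharP F p] (hp2 : p ≠ 2)
    {ψ : AddChar F ℂ} (hψ : ψ ≠ 1) (α : Fˣ) {K : Type*} [Field K] [Algebra ℚ K]
    [FiniteDimensional ℚ K] (τ : K →ₐ[ℚ] ℂ) (ψK : AddChar F K) (hτ : ∀ x, τ (ψK x) = ψ x) :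
    1 ≤ (4 * Fintype.card F - (kloostermanSum ψ α).re ^ 2) *
      (4 * Fintype.card F : ℝ) ^ (Module.finrank ℚ K - 1) := by
  classical
  let X : K := 4 * (Fintype.card F : ℕ) - (-∑ x : Fˣ, ψK ((x : F) + (α : F) / (x : F))) ^ 2
  let χ : (K →ₐ[ℚ] ℂ) → AddChar F ℂ := fun σ => (σ : K →* ℂ).compAddChar ψK
  have hval : χ τ = ψ := by
    ext x
    exact hτ x
  have hχ : ∀ σ, χ σ ≠ 1 := by
    intro σ
    rw [AddChar.ne_one_iff] at hψ ⊢
    obtain ⟨x, hx⟩ := hψ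
    refine ⟨x, fun h => hx ?_⟩
    have h1 : σ (ψK x) = σ 1 := by rw [map_one]; exact h
    rw [← hτ, σ.toRingHom.injective h1, map_one]
  have hσ : ∀ σ : K →ₐ[ℚ] ℂ,
      σ X = ((4 * Fintype.card F - (kloostermanSum (χ σ) α).re ^ 2 : ℝ) : ℂ) := by
    intro σ
    push_cast
    rw [kloostermanSum_eq_ofReal_re, kloostermanSum]
    simp only [X, map_sub, map_mul, map_pow, map_neg, map_sum, map_natCast, map_ofNat]
    rfl
  have hnonneg : ∀ σ : K →ₐ[ℚ] ℂ,
      0 ≤ 4 * (Fintype.card F : ℝ) - (kloostermanSum (χ σ) α).re ^ 2 := fun σ =>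
    sub_nonneg.mpr (sq_re_kloostermanSum_le p hp2 (χ σ) (hχ σ) α)
  have hX0 : X ≠ 0 := by
    intro h
    have h1 := hσ τ
    rw [h, map_zero, hval] at h1
    push_cast at h1
    rw [kloostermanSum_eq_ofReal_re] at h1
    exact kloostermanSum_sq_ne p ψ α (sub_eq_zero.mp h1.symm).symm
  have hψint : ∀ x, IsIntegral ℤ (ψK x) := fun x => by
    have h1 := isIntegral_addChar p ψ x
    rw [← hτ] at h1
    exact (isIntegral_algHom_iff (τ.toRingHom.toIntAlgHom) τ.toRingHom.injective).mp h1
  have hXint : IsIntegral ℤ X := by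
    refine IsIntegral.sub ?_ (((IsIntegral.sum _ fun x _ => hψint _).neg).pow 2)
    have : IsIntegral ℤ (((4 * Fintype.card F : ℕ) : ℤ) : K) := isIntegral_algebraMap
    simpa using this
  obtain ⟨z, hz⟩ := IsIntegrallyClosed.isIntegral_iff.mp (Algebra.isIntegral_norm ℚ hXint)
  have hz0 : z ≠ 0 := by
    rintro rfl
    rw [map_zero] at hz
    exact hX0 (Algebra.norm_eq_zero_iff.mp hz.symm)
  have hprod : ((z : ℝ) : ℂ) = ((∏ σ : K →ₐ[ℚ] ℂ,
      (4 * Fintype.card F - (kloostermanSum (χ σ) α).re ^ 2 : ℝ) : ℝ) : ℂ) := by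
    have h1 := Algebra.norm_eq_prod_embeddings ℚ ℂ X
    rw [← hz] at h1
    rw [Complex.ofReal_prod, ← Finset.prod_congr rfl (fun σ _ => hσ σ), ← h1]
    simp
  rw [Complex.ofReal_inj] at hprod
  have hone : 1 ≤ |(z : ℝ)| := by exact_mod_cast Int.one_le_abs hz0
  rw [hprod, abs_of_nonneg (Finset.prod_nonneg fun σ _ => hnonneg σ),
    ← Finset.mul_prod_erase _ _ (Finset.mem_univ τ), hval] at hone
  refine hone.trans (mul_le_mul_of_nonneg_left ?_ (hval ▸ hnonneg τ))
  rw [← AlgHom.card ℚ K ℂ, ← Finset.card_univ (α := K →ₐ[ℚ] ℂ),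
    ← Finset.card_erase_of_mem (Finset.mem_univ τ), ← Finset.prod_const]
  refine Finset.prod_le_prod (fun σ _ => hnonneg σ) fun σ _ => ?_
  linarith [sq_nonneg (kloostermanSum (χ σ) α).re]

theorem one_le_four_mul_card_sub_sq_of_isCyclotomicExtension (p : ℕ) [hp : Fact p.Prime] [CharP F p] (hp2 : p ≠ 2)
    (ψ : AddChar F ℂ) (hψ : ψ ≠ 1) (α : Fˣ)
    (K : Type*) [Field K] [Algebra ℚ K] [IsCyclotomicExtension {p} ℚ K] :
    1 ≤ (4 * Fintype.card F - (kloostermanSum ψ α).re ^ 2) * (4 * Fintype.card F : ℝ) ^ (p - 2) := by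
  have : NeZero p := ⟨hp.out.ne_zero⟩
  have : FiniteDimensional ℚ K := IsCyclotomicExtension.finiteDimensional {p} ℚ K
  have hrank : Module.finrank ℚ K = p - 1 := by
    rw [IsCyclotomicExtension.finrank K (Polynomial.cyclotomic.irreducible_rat hp.out.pos),
      Nat.totient_prime hp.out]
  let τ : K →ₐ[ℚ] ℂ := IsAlgClosed.lift
  have hζ := (IsCyclotomicExtension.zeta_spec p ℚ K).map_of_injective τ.toRingHom.injective
  choose i _ hi using fun x => hζ.eq_pow_of_pow_eq_one (addChar_pow_char_eq_one p ψ x)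
  have hτ : ∀ x, τ (IsCyclotomicExtension.zeta p ℚ K ^ i x) = ψ x := fun x => by
    rw [map_pow]
    exact hi x
  let ψK : AddChar F K :=
    { toFun := fun x => IsCyclotomicExtension.zeta p ℚ K ^ i x
      map_zero_eq_one' := τ.toRingHom.injective (by
        rw [map_one]
        exact (hτ 0).trans (AddChar.map_zero_eq_one ψ))
      map_add_eq_mul' := fun x y => τ.toRingHom.injective (by
        rw [map_mul]
        exact (hτ _).trans ((AddChar.map_add_eq_mul ψ x y).trans
          (congrArg₂ _ (hτ x) (hτ y)).symm)) }
  have h := one_le_four_mul_card_sub_sq_of_embedding p hp2 hψ α τ ψK hτ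
  rwa [hrank, Nat.sub_sub] at h

theorem one_le_four_mul_card_sub_sq (p : ℕ) [Fact p.Prime] [CharP F p] (hp2 : p ≠ 2)
    (ψ : AddChar F ℂ) (hψ : ψ ≠ 1) (α : Fˣ) :
    1 ≤ (4 * Fintype.card F - (kloostermanSum ψ α).re ^ 2) * (4 * Fintype.card F : ℝ) ^ (p - 2) := by
  have : NeZero p := ⟨(Fact.out : p.Prime).ne_zero⟩
  obtain ⟨K, _, _, _⟩ : ∃ (K : Type) (_ : Field K) (_ : Algebra ℚ K),
      IsCyclotomicExtension {p} ℚ K := ⟨_, _, _, CyclotomicField.isCyclotomicExtension p ℚ⟩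
  exact one_le_four_mul_card_sub_sq_of_isCyclotomicExtension p hp2 ψ hψ α K

end Arithmetic

section Angle

variable {F : Type u} [Fintype F]

theorem rpow_half_sq_card : ((Fintype.card F : ℝ) ^ (1 / 2 : ℝ)) ^ 2 = Fintype.card F := by
  rw [← Real.rpow_natCast, ← Real.rpow_mul (Nat.cast_nonneg _)]
  norm_num

variable [Field F] [DecidableEq F]

theorem exists_isKloostermanAngle (p : ℕ) [Fact p.Prime] [CharP F p] (hp2 : p ≠ 2)
    (ψ : AddChar F ℂ) (hψ : ψ ≠ 1) (α : Fˣ) : ∃ θ, IsKloostermanAngle ψ α θ := by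
  set s := (Fintype.card F : ℝ) ^ (1 / 2 : ℝ) with hs
  have hs0 : 0 < s := Real.rpow_pos_of_pos (by exact_mod_cast Fintype.card_pos) _
  have hs2 : s ^ 2 = Fintype.card F := rpow_half_sq_card
  have h := sq_re_kloostermanSum_le p hp2 ψ hψ α
  rw [← hs2, show 4 * s ^ 2 = (2 * s) ^ 2 by ring] at h
  have habs := abs_le.mp (abs_le_of_sq_le_sq h (by positivity))
  refine ⟨Real.arccos ((kloostermanSum ψ α).re / (2 * s)),
    ⟨Real.arccos_nonneg _, Real.arccos_le_pi _⟩, ?_⟩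
  rw [Real.cos_arccos, mul_div_cancel₀ _ (by positivity), kloostermanSum_eq_ofReal_re]
  · rw [le_div_iff₀ (by positivity)]; linarith [habs.1]
  · rw [div_le_iff₀ (by positivity)]; linarith [habs.2]

theorem one_le_mul_sin_sq (p : ℕ) [hp : Fact p.Prime] [CharP F p] (hp2 : p ≠ 2)
    (ψ : AddChar F ℂ) (hψ : ψ ≠ 1) (α : Fˣ) {θ : ℝ} (hθ : IsKloostermanAngle ψ α θ) :
    1 ≤ (4 * Fintype.card F : ℝ) ^ (p - 1) * Real.sin θ ^ 2 := by
  have h := one_le_four_mul_card_sub_sq p hp2 ψ hψ α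
  have hre : (kloostermanSum ψ α).re = 2 * (Fintype.card F : ℝ) ^ (1 / 2 : ℝ) * Real.cos θ := by
    rw [hθ.2, Complex.ofReal_re]
  have hsq := rpow_half_sq_card (F := F)
  have e : 4 * Fintype.card F - (kloostermanSum ψ α).re ^ 2
      = (4 * Fintype.card F) * Real.sin θ ^ 2 := by
    rw [hre, mul_pow, mul_pow, hsq, Real.sin_sq]
    ring
  have hp1 : p - 1 = p - 2 + 1 := by have := hp.out.two_le; omega
  rw [e] at h
  rw [hp1, pow_succ]
  linarith

theorem rpow_neg_lt_of_one_le_mul_sin_sq {p : ℕ} (hp : 2 ≤ p) {q t : ℝ} (hq : 3 ≤ q) (ht : 0 ≤ t)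
    (h : 1 ≤ (4 * q) ^ (p - 1) * Real.sin t ^ 2) : q ^ (-(2 * ((p : ℝ) - 1))) < |t| := by
  rw [abs_of_nonneg ht]
  by_contra! hle
  have hq0 : 0 < q := by linarith
  have e : q ^ (-(2 * ((p : ℝ) - 1))) = ((q ^ 2) ^ (p - 1))⁻¹ := by
    rw [Real.rpow_neg hq0.le, ← pow_mul, ← Real.rpow_natCast]
    push_cast [Nat.cast_sub (show 1 ≤ p by omega)]
    rfl
  rw [e] at hle
  have hsin : Real.sin t ^ 2 ≤ (((q ^ 2) ^ (p - 1))⁻¹) ^ 2 :=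
    Real.sin_sq_le_sq.trans (pow_le_pow_left₀ ht hle 2)
  have h1 : 1 ≤ (4 * q) ^ (p - 1) * (((q ^ 2) ^ (p - 1))⁻¹) ^ 2 :=
    h.trans (mul_le_mul_of_nonneg_left hsin (by positivity))
  have e2 : (4 * q) ^ (p - 1) * (((q ^ 2) ^ (p - 1))⁻¹) ^ 2 = (4 / q ^ 3) ^ (p - 1) := by
    rw [← inv_pow, ← pow_mul, mul_comm (p - 1), pow_mul, ← mul_pow]
    congr 1
    field_simp
  rw [e2] at h1
  have h27 : (27 : ℝ) ≤ q ^ 3 := by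
    have := pow_le_pow_left₀ (by norm_num) hq 3
    norm_num at this
    exact this
  have hlt : (4 / q ^ 3) ^ (p - 1) < 1 := by
    refine pow_lt_one₀ (by positivity) ?_ (by omega)
    rw [div_lt_one (by positivity)]
    linarith
  linarith

theorem norm_kloostermanSum_le_of_angle {ψ : AddChar F ℂ} {α : Fˣ} {θ ε : ℝ}
    (hθ : IsKloostermanAngle ψ α θ) (hε : 0 ≤ ε) (h1 : ε ≤ θ) (h2 : ε ≤ Real.pi - θ) :
    ‖kloostermanSum ψ α‖ ≤
      2 * (Fintype.card F : ℝ) ^ (1 / 2 : ℝ) * (1 - 2 / Real.pi ^ 2 * ε ^ 2) := by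
  have hs0 : 0 ≤ 2 * (Fintype.card F : ℝ) ^ (1 / 2 : ℝ) := by positivity
  rw [hθ.2, Complex.norm_real, Real.norm_eq_abs, abs_mul, abs_of_nonneg hs0]
  refine mul_le_mul_of_nonneg_left ?_ hs0
  have key : ∀ t : ℝ, ε ≤ t → t ≤ Real.pi → Real.cos t ≤ 1 - 2 / Real.pi ^ 2 * ε ^ 2 := by
    intro t ht ht'
    refine (Real.cos_le_one_sub_mul_cos_sq
      (abs_le.mpr ⟨by linarith [Real.pi_pos], ht'⟩)).trans ?_
    have := mul_le_mul_of_nonneg_left (pow_le_pow_left₀ hε ht 2)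
      (show 0 ≤ 2 / Real.pi ^ 2 by positivity)
    linarith
  rw [abs_le']
  refine ⟨key θ h1 hθ.1.2, ?_⟩
  rw [← Real.cos_pi_sub]
  exact key _ h2 (by linarith [hθ.1.1])

end Angle

theorem mainTheorem8 (p : ℕ) (hprime : p.Prime) (hp : 3 ≤ p) :
    IsKloostermanAngleConstant.{u} p (2 * ((p : ℝ) - 1)) ∧
    ∀ c : ℝ, IsKloostermanAngleConstant.{u} p c →
      ∀ (F : Type u) [Field F] [Fintype F] [DecidableEq F] [CharP F p]
        (ψ : AddChar F ℂ) (_ : ψ ≠ 1) (α : Fˣ),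
        ‖kloostermanSum ψ α‖ ≤
          2 * (Fintype.card F : ℝ) ^ (1 / 2 : ℝ) *
            (1 - 2 / Real.pi ^ 2 * (Fintype.card F : ℝ) ^ (-2 * c)) := by
  have : Fact p.Prime := ⟨hprime⟩
  have hp2 : p ≠ 2 := by omega
  refine ⟨⟨?_, ?_⟩, ?_⟩
  · have : (3 : ℝ) ≤ p := by exact_mod_cast hp
    linarith
  · intro F _ _ _ _ ψ hψ α
    obtain ⟨θ, hθ⟩ := exists_isKloostermanAngle p hp2 ψ hψ α
    have hq : (3 : ℝ) ≤ Fintype.card F := by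
      obtain ⟨⟨n, hn0⟩, -, hn⟩ := FiniteField.card F p
      have : p ^ 1 ≤ Fintype.card F := by
        rw [hn]
        exact Nat.pow_le_pow_right hprime.pos hn0
      exact_mod_cast hp.trans (by simpa using this)
    have h := one_le_mul_sin_sq p hp2 ψ hψ α hθ
    refine ⟨θ, hθ, rpow_neg_lt_of_one_le_mul_sin_sq (by omega) hq hθ.1.1 h,
      rpow_neg_lt_of_one_le_mul_sin_sq (by omega) hq (sub_nonneg.mpr hθ.1.2) ?_⟩
    rwa [Real.sin_pi_sub]
  · intro c hc F _ _ _ _ ψ hψ α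
    obtain ⟨θ, hθ, h1, h2⟩ := hc.2 F ψ hψ α
    rw [abs_of_nonneg hθ.1.1] at h1
    rw [abs_of_nonneg (sub_nonneg.mpr hθ.1.2)] at h2
    have h := norm_kloostermanSum_le_of_angle hθ (Real.rpow_nonneg (Nat.cast_nonneg _) _) h1.le h2.le
    rwa [← Real.rpow_natCast (_ ^ (-c)), ← Real.rpow_mul (Nat.cast_nonneg _),
      show -c * ((2 : ℕ) : ℝ) = -2 * c by push_cast; ring] at h
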